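/- Let $L^2(0,\infty)$ be the complex Lebesgue space, and let $\mathcal{H}_\infty$ be the bounded Hardy operator on it, $(\mathcal{H}_\infty f)(x)=\frac1x\int_0^x f(t)\,dt$ for $0<x<\infty$. Let $L^p(i\mathbb{R})$ be taken with respect to Lebesgue measure $dy$ at the points $iy$, and let $\mathcal{Q}:L^2(0,\infty)\to L^2(i\mathbb{R})$ be the unitary Mellin transform $$(\mathcal{Q}f)(iy)=\frac{1}{\sqrt{2\pi}}\int_0^\infty f(u)\,u^{iy-\frac12}\,du .$$ For $g\in L^\infty(i\mathbb{R})$ let $M_g$ be the operator of multiplication by $g$ on $L^2(i\mathbb{R})$. Let $A$ be a bounded linear operator on $L^2(0,\infty)$. Then $A\mathcal{H}_\infty=\mathcal{H}_\infty A$ if and only if there exists $g\in L^\infty(i\mathbb{R})$ such that $$(Af)(t)=\frac{1}{2\pi}\int_{-\infty}^{\infty}t^{-iy-\frac12}\,g(iy)\Big(\int_0^\infty f(u)\,u^{iy-\frac12}\,du\Big)dy\qquad\text{for all } f\in L^2(0,\infty),$$ where the integrals are understood in the $L^2$ sense: the inner one is the limit in $L^2(\mathbb{R},dy)$ of $\int_{1/R}^{R}f(u)u^{iy-\frac12}\,du$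 as $R\to\infty$, and the outer one is the limit in $L^2(0,\infty)$ of the integrals over $[-R,R]$ as $R\to\infty$. Moreover, for each $g\in L^\infty(i\mathbb{R})$ this formula holds for all $f$ if and only if $A=\mathcal{Q}^{-1}M_g\mathcal{Q}$; consequently, $A$ commutes with $\mathcal{H}_\infty$ if and only if $A=\mathcal{Q}^{-1}M_g\mathcal{Q}$ for some $g\in L^\infty(i\mathbb{R})$. -/

import Mathlib

open MeasureTheory Set
open scoped ENNReal Topology

namespace HardyMellin

noncomputable section

/-- The complex Hilbert space `L²(0, ∞)`. -/
abbrev L2Pos : Type := Lp ℂ 2 (volume.restrict (Ioi (0 : ℝ)))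

/-- The space `L²(iℝ)`, a function on `iℝ` being written as a function of the real parameter `β`
of the point `iβ`. -/
abbrev L2Line : Type := Lp ℂ 2 (volume : Measure ℝ)

/-- The average `(1 / x) ∫₀ˣ f(t) dt`. -/
def hardyFun (f : ℝ → ℂ) (x : ℝ) : ℂ := (1 / (x : ℂ)) * ∫ t in Ioc 0 x, f t

theorem hardyFun_stronglyMeasurable {f : ℝ → ℂ} (hf : StronglyMeasurable f) :
    StronglyMeasurable (hardyFun f) := by
  have h1 : StronglyMeasurable (fun x : ℝ => ∫ t in Ioc 0 x, f t) := by
    have h2 : StronglyMeasurable (fun p : ℝ × ℝ =>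
        ({q : ℝ × ℝ | 0 < q.2 ∧ q.2 ≤ q.1}).indicator (fun q => f q.2) p) := by
      refine (hf.comp_measurable measurable_snd).indicator ?_
      exact (measurableSet_lt measurable_const measurable_snd).inter
        (measurableSet_le measurable_snd measurable_fst)
    have h3 := h2.integral_prod_right' (ν := (volume : Measure ℝ))
    convert h3 using 2 with x
    rw [← integral_indicator measurableSet_Ioc]
    rfl
  have h2 : Measurable (fun x : ℝ => 1 / (x : ℂ)) := by fun_prop
  exact h2.stronglyMeasurable.mul h1

theorem lintegral_rpow_Ioc_zero {x : ℝ} (hx : 0 < x) :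
    ∫⁻ t in Ioc 0 x, ENNReal.ofReal (t ^ (-(1 / 2) : ℝ)) =
      ENNReal.ofReal (2 * x ^ (1 / 2 : ℝ)) := by
  have hi : IntegrableOn (fun t : ℝ => t ^ (-(1 / 2) : ℝ)) (Ioc 0 x) := by
    have := intervalIntegral.intervalIntegrable_rpow' (a := 0) (b := x) (r := -(1 / 2))
      (by norm_num)
    rwa [intervalIntegrable_iff_integrableOn_Ioc_of_le hx.le] at this
  rw [← ofReal_integral_eq_lintegral_ofReal hi]
  · rw [← intervalIntegral.integral_of_le hx.le, integral_rpow (Or.inl (by norm_num))]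
    congr 1
    norm_num
    ring
  · filter_upwards [ae_restrict_mem measurableSet_Ioc] with t ht
    exact Real.rpow_nonneg ht.1.le _

theorem lintegral_rpow_Ici {t : ℝ} (ht : 0 < t) :
    ∫⁻ x in Ici t, ENNReal.ofReal (x ^ (-(3 / 2) : ℝ)) =
      ENNReal.ofReal (2 * t ^ (-(1 / 2) : ℝ)) := by
  rw [setLIntegral_congr Ioi_ae_eq_Ici.symm, ← ofReal_integral_eq_lintegral_ofReal
    (integrableOn_Ioi_rpow_of_lt (by norm_num) ht)]
  · rw [integral_Ioi_rpow_of_lt (by norm_num) ht]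
    congr 1
    norm_num
    ring
  · filter_upwards [ae_restrict_mem measurableSet_Ioi] with x hx
    exact Real.rpow_nonneg (ht.trans hx).le _

theorem hardyFun_enorm_sq_le {f : ℝ → ℂ} (hf : StronglyMeasurable f) {x : ℝ} (hx : 0 < x) :
    ‖hardyFun f x‖ₑ ^ 2 ≤ 2 * (ENNReal.ofReal (x ^ (-(3 / 2) : ℝ)) *
      ∫⁻ t in Ioc 0 x, ENNReal.ofReal (t ^ (1 / 2 : ℝ)) * ‖f t‖ₑ ^ 2) := by
  have hm : Measurable (fun t => ‖f t‖ₑ) := hf.measurable.enorm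
  have h1 : ‖∫ t in Ioc 0 x, f t‖ₑ ≤
      (∫⁻ t in Ioc 0 x, ENNReal.ofReal (t ^ (1 / 2 : ℝ)) * ‖f t‖ₑ ^ 2) ^ (1 / 2 : ℝ) *
      (∫⁻ t in Ioc 0 x, ENNReal.ofReal (t ^ (-(1 / 2) : ℝ))) ^ (1 / 2 : ℝ) := by
    refine (enorm_integral_le_lintegral_enorm _).trans ?_
    have h2 := ENNReal.lintegral_mul_le_Lp_mul_Lq (volume.restrict (Ioc 0 x))
      (p := 2) (q := 2) Real.HolderConjugate.two_two
      (f := fun t => ENNReal.ofReal (t ^ (1 / 4 : ℝ)) * ‖f t‖ₑ)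
      (g := fun t => ENNReal.ofReal (t ^ (-(1 / 4) : ℝ)))
      (by fun_prop) (by fun_prop)
    refine le_trans (le_of_eq ?_) (h2.trans (le_of_eq ?_))
    · refine setLIntegral_congr_fun measurableSet_Ioc fun t ht => ?_
      simp only [Pi.mul_apply]
      rw [mul_right_comm, ← ENNReal.ofReal_mul (Real.rpow_nonneg ht.1.le _),
        ← Real.rpow_add ht.1]
      norm_num
    · congr 2
      · refine setLIntegral_congr_fun measurableSet_Ioc fun t ht => ?_
        rw [ENNReal.mul_rpow_of_nonneg _ _ (by norm_num : (0 : ℝ) ≤ 2),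
          ENNReal.ofReal_rpow_of_nonneg (Real.rpow_nonneg ht.1.le _) (by norm_num),
          ← Real.rpow_mul ht.1.le]
        norm_num
      · refine setLIntegral_congr_fun measurableSet_Ioc fun t ht => ?_
        rw [ENNReal.ofReal_rpow_of_nonneg (Real.rpow_nonneg ht.1.le _) (by norm_num),
          ← Real.rpow_mul ht.1.le]
        norm_num
  rw [lintegral_rpow_Ioc_zero hx] at h1
  set J := ∫⁻ t in Ioc 0 x, ENNReal.ofReal (t ^ (1 / 2 : ℝ)) * ‖f t‖ₑ ^ 2
  have h3 : ‖∫ t in Ioc 0 x, f t‖ₑ ^ 2 ≤ J * ENNReal.ofReal (2 * x ^ (1 / 2 : ℝ)) := by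
    refine (pow_le_pow_left₀ zero_le h1 2).trans (le_of_eq ?_)
    rw [mul_pow, ← ENNReal.rpow_mul_natCast, ← ENNReal.rpow_mul_natCast]
    norm_num
  have h4 : ‖(1 / (x : ℂ))‖ₑ ^ 2 = ENNReal.ofReal (x ^ (-2 : ℝ)) := by
    rw [← ofReal_norm, ← ENNReal.ofReal_pow (norm_nonneg _)]
    congr 1
    rw [norm_div, norm_one, Complex.norm_real, Real.norm_of_nonneg hx.le,
      Real.rpow_neg hx.le]
    simp
  unfold hardyFun
  rw [enorm_mul, mul_pow, h4]
  refine (mul_le_mul_right h3 _).trans (le_of_eq ?_)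
  have h5 : ENNReal.ofReal (x ^ (-2 : ℝ)) * ENNReal.ofReal (2 * x ^ (1 / 2 : ℝ)) =
      2 * ENNReal.ofReal (x ^ (-(3 / 2) : ℝ)) := by
    rw [← ENNReal.ofReal_mul (Real.rpow_nonneg hx.le _), mul_left_comm, ← Real.rpow_add hx,
      ENNReal.ofReal_mul (by norm_num)]
    norm_num
  rw [mul_left_comm, h5]
  ring

/-- Hardy's inequality. -/
theorem lintegral_hardyFun_sq_le {f : ℝ → ℂ} (hf : StronglyMeasurable f) :
    ∫⁻ x in Ioi 0, ‖hardyFun f x‖ₑ ^ 2 ≤ 4 * ∫⁻ x in Ioi 0, ‖f x‖ₑ ^ 2 := by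
  have hm : Measurable (fun t => ‖f t‖ₑ) := hf.measurable.enorm
  set S : Set (ℝ × ℝ) := {q | 0 < q.2 ∧ q.2 ≤ q.1} with hS
  have hSm : MeasurableSet S :=
    (measurableSet_lt measurable_const measurable_snd).inter
      (measurableSet_le measurable_snd measurable_fst)
  set k : ℝ × ℝ → ℝ≥0∞ := S.indicator (fun q => ENNReal.ofReal (q.1 ^ (-(3 / 2) : ℝ)) *
      (ENNReal.ofReal (q.2 ^ (1 / 2 : ℝ)) * ‖f q.2‖ₑ ^ 2)) with hk
  have hkm : Measurable k := by
    refine Measurable.indicator ?_ hSm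
    have : Measurable fun q : ℝ × ℝ => ‖f q.2‖ₑ := hm.comp measurable_snd
    fun_prop
  calc ∫⁻ x in Ioi 0, ‖hardyFun f x‖ₑ ^ 2
      ≤ ∫⁻ x in Ioi 0, 2 * ∫⁻ t in Ioi 0, k (x, t) := by
        refine setLIntegral_mono' measurableSet_Ioi fun x hx => ?_
        refine (hardyFun_enorm_sq_le hf hx).trans (le_of_eq ?_)
        congr 1
        rw [← lintegral_const_mul _ (by fun_prop), ← lintegral_indicator measurableSet_Ioc,
          ← lintegral_indicator measurableSet_Ioi]
        congr 1 with t
        by_cases ht : 0 < t <;> by_cases htx : t ≤ x <;> simp [k, S, indicator, ht, htx]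
    _ = 2 * ∫⁻ t in Ioi 0, ∫⁻ x in Ioi 0, k (x, t) := by
        rw [lintegral_const_mul _ (hkm.lintegral_prod_right'), lintegral_lintegral_swap]
        exact hkm.aemeasurable
    _ = 2 * ∫⁻ t in Ioi 0, 2 * ‖f t‖ₑ ^ 2 := by
        congr 1
        refine setLIntegral_congr_fun measurableSet_Ioi fun t ht => ?_
        have ht' : 0 < t := ht
        have : ∫⁻ x in Ioi 0, k (x, t) = ∫⁻ x in Ici t, ENNReal.ofReal (x ^ (-(3 / 2) : ℝ)) *
            (ENNReal.ofReal (t ^ (1 / 2 : ℝ)) * ‖f t‖ₑ ^ 2) := by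
          rw [← lintegral_indicator measurableSet_Ioi, ← lintegral_indicator measurableSet_Ici]
          congr 1 with x
          by_cases htx : t ≤ x
          · have : 0 < x := ht'.trans_le htx
            simp [k, S, indicator, ht', htx, this]
          · simp [k, S, indicator, htx]
        simp only [this]
        rw [lintegral_mul_const _ (by fun_prop), lintegral_rpow_Ici ht', ← mul_assoc,
          ← ENNReal.ofReal_mul (by positivity), mul_assoc, ← Real.rpow_add ht']
        norm_num
    _ = 4 * ∫⁻ x in Ioi 0, ‖f x‖ₑ ^ 2 := by
        rw [lintegral_const_mul _ (by fun_prop), ← mul_assoc]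
        norm_num

theorem eLpNorm_two_eq {α : Type*} [MeasurableSpace α] (μ : Measure α) (f : α → ℂ) :
    eLpNorm f 2 μ = (∫⁻ x, ‖f x‖ₑ ^ 2 ∂μ) ^ (1 / 2 : ℝ) := by
  rw [eLpNorm_eq_lintegral_rpow_enorm_toReal (by norm_num) (by norm_num)]
  simp

theorem eLpNorm_hardyFun_le {f : ℝ → ℂ} (hf : StronglyMeasurable f) :
    eLpNorm (hardyFun f) 2 (volume.restrict (Ioi 0)) ≤
      2 * eLpNorm f 2 (volume.restrict (Ioi 0)) := by
  rw [eLpNorm_two_eq, eLpNorm_two_eq]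
  refine (ENNReal.rpow_le_rpow (lintegral_hardyFun_sq_le hf) (by norm_num)).trans (le_of_eq ?_)
  rw [ENNReal.mul_rpow_of_nonneg _ _ (by norm_num)]
  congr 1
  rw [show (4 : ℝ≥0∞) = 2 ^ (2 : ℝ) by norm_num, ← ENNReal.rpow_mul]
  norm_num

theorem hardyFun_memLp (f : L2Pos) : MemLp (hardyFun f) 2 (volume.restrict (Ioi 0)) :=
  ⟨(hardyFun_stronglyMeasurable (Lp.stronglyMeasurable f)).aestronglyMeasurable,
    (eLpNorm_hardyFun_le (Lp.stronglyMeasurable f)).trans_lt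
      (ENNReal.mul_lt_top (by norm_num) (Lp.eLpNorm_lt_top f))⟩

theorem L2Pos.integrableOn_Ioc (f : L2Pos) (x : ℝ) : IntegrableOn f (Ioc 0 x) := by
  have h : MemLp f 2 (volume.restrict (Ioc 0 x)) :=
    (Lp.memLp f).mono_measure (Measure.restrict_mono Ioc_subset_Ioi_self le_rfl)
  exact h.integrable (by norm_num)

theorem setIntegral_Ioc_congr {f g : ℝ → ℂ} (h : f =ᵐ[volume.restrict (Ioi 0)] g) (x : ℝ) :
    ∫ t in Ioc 0 x, f t = ∫ t in Ioc 0 x, g t :=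
  integral_congr_ae (ae_mono (Measure.restrict_mono Ioc_subset_Ioi_self le_rfl) h)

/-- The Hardy operator `H_∞` on `L²(0, ∞)`, `(H_∞ f)(x) = (1 / x) ∫₀ˣ f(t) dt`. -/
def hardyInfty : L2Pos →L[ℂ] L2Pos :=
  LinearMap.mkContinuous
    { toFun := fun f => (hardyFun_memLp f).toLp (hardyFun f)
      map_add' := fun f g => by
        rw [← MemLp.toLp_add]
        refine MemLp.toLp_congr _ _ (Filter.Eventually.of_forall fun x => ?_)
        simp only [hardyFun, Pi.add_apply]
        rw [setIntegral_Ioc_congr (Lp.coeFn_add f g), ← mul_add]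
        congr 1
        exact integral_add (L2Pos.integrableOn_Ioc f x) (L2Pos.integrableOn_Ioc g x)
      map_smul' := fun c f => by
        rw [RingHom.id_apply, ← MemLp.toLp_const_smul]
        refine MemLp.toLp_congr _ _ (Filter.Eventually.of_forall fun x => ?_)
        simp only [hardyFun, Pi.smul_apply]
        rw [setIntegral_Ioc_congr (Lp.coeFn_smul c f), ← mul_smul_comm]
        congr 1
        exact integral_smul c _ }
    2 (fun f => by
      rw [LinearMap.coe_mk, AddHom.coe_mk, Lp.norm_toLp, Lp.norm_def]
      have h := ENNReal.toReal_mono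
        (ENNReal.mul_lt_top (by norm_num) (Lp.eLpNorm_lt_top f)).ne
        (eLpNorm_hardyFun_le (Lp.stronglyMeasurable f))
      simpa using h)

/-- The substitution `t = exp (2πx)`: `x ↦ √(2π) e^{πx} f(e^{2πx})`. -/
def logPull (f : ℝ → ℂ) (x : ℝ) : ℂ :=
  ((√(2 * Real.pi) * Real.exp (Real.pi * x) : ℝ) : ℂ) * f (Real.exp (2 * Real.pi * x))

/-- The inverse substitution `x = log t / (2π)`. -/
def logPush (h : ℝ → ℂ) (t : ℝ) : ℂ :=
  ((√(2 * Real.pi) * √t : ℝ) : ℂ)⁻¹ * h (Real.log t / (2 * Real.pi))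

theorem image_exp_univ : (fun x : ℝ => Real.exp (2 * Real.pi * x)) '' univ = Ioi 0 := by
  have hpi := Real.pi_pos
  ext t
  simp only [image_univ, mem_range, mem_Ioi]
  constructor
  · rintro ⟨x, rfl⟩
    exact Real.exp_pos _
  · intro ht
    refine ⟨Real.log t / (2 * Real.pi), ?_⟩
    rw [mul_div_cancel₀ _ (by positivity), Real.exp_log ht]

theorem hasDerivWithinAt_exp_two_pi : ∀ x ∈ (univ : Set ℝ),
    HasDerivWithinAt (fun x : ℝ => Real.exp (2 * Real.pi * x))
      (2 * Real.pi * Real.exp (2 * Real.pi * x)) univ x := by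
  intro x _
  have := ((hasDerivAt_id x).const_mul (2 * Real.pi)).exp
  simp only [id, mul_one] at this
  rw [mul_comm (Real.exp _)] at this
  exact this.hasDerivWithinAt

theorem injOn_exp_two_pi : InjOn (fun x : ℝ => Real.exp (2 * Real.pi * x)) univ := by
  intro x _ y _ hxy
  have hpi := Real.pi_pos
  exact mul_left_cancel₀ (by positivity) (Real.exp_injective hxy)

theorem lintegral_Ioi_eq_exp (F : ℝ → ℝ≥0∞) :
    ∫⁻ t in Ioi 0, F t = ∫⁻ x : ℝ, ENNReal.ofReal (2 * Real.pi * Real.exp (2 * Real.pi * x)) *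
      F (Real.exp (2 * Real.pi * x)) := by
  have hpi := Real.pi_pos
  rw [← image_exp_univ, lintegral_image_eq_lintegral_abs_deriv_mul MeasurableSet.univ
    hasDerivWithinAt_exp_two_pi injOn_exp_two_pi, Measure.restrict_univ]
  congr 1 with x
  rw [abs_of_pos (by positivity)]

theorem eLpNorm_logPull (f : ℝ → ℂ) :
    eLpNorm (logPull f) 2 volume = eLpNorm f 2 (volume.restrict (Ioi 0)) := by
  have hpi := Real.pi_pos
  rw [eLpNorm_two_eq, eLpNorm_two_eq, lintegral_Ioi_eq_exp]
  congr 2 with x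
  rw [logPull, enorm_mul, mul_pow, ← ofReal_norm, Complex.norm_real,
    Real.norm_of_nonneg (by positivity), ← ENNReal.ofReal_pow (by positivity), mul_pow,
    Real.sq_sqrt (by positivity), ← Real.exp_nat_mul]
  congr 4
  push_cast
  ring

theorem exp_quasiMeasurePreserving :
    Measure.QuasiMeasurePreserving (fun x : ℝ => Real.exp (2 * Real.pi * x)) volume
      (volume.restrict (Ioi 0)) := by
  have hpi := Real.pi_pos
  have hm : Measurable (fun x : ℝ => Real.exp (2 * Real.pi * x)) := by fun_prop
  refine ⟨hm, Measure.AbsolutelyContinuous.mk fun s hs h0 => ?_⟩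
  rw [Measure.map_apply hm hs]
  have h1 := lintegral_Ioi_eq_exp (s.indicator 1)
  rw [lintegral_indicator_one hs, h0, eq_comm, lintegral_eq_zero_iff
    (by
      have : Measurable (s.indicator (1 : ℝ → ℝ≥0∞)) := measurable_one.indicator hs
      fun_prop)] at h1
  rw [measure_eq_zero_iff_ae_notMem]
  filter_upwards [h1] with x hx hxs
  have hxs' : Real.exp (2 * Real.pi * x) ∈ s := hxs
  simp only [hxs', indicator_of_mem, Pi.one_apply, mul_one, Pi.zero_apply,
    ENNReal.ofReal_eq_zero] at hx
  exact absurd hx (not_le.mpr (by positivity))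

theorem logPull_congr {f g : ℝ → ℂ} (h : f =ᵐ[volume.restrict (Ioi 0)] g) :
    logPull f =ᵐ[volume] logPull g := by
  filter_upwards [exp_quasiMeasurePreserving.ae_eq h] with x hx
  simp only [Function.comp_apply] at hx
  simp only [logPull, hx]

theorem logPull_memLp (f : L2Pos) : MemLp (logPull f) 2 volume := by
  refine ⟨?_, by rw [eLpNorm_logPull]; exact Lp.eLpNorm_lt_top f⟩
  have h1 : Measurable (f : ℝ → ℂ) := (Lp.stronglyMeasurable f).measurable
  have h2 : Measurable (logPull f) := by
    unfold logPull
    fun_prop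
  exact h2.aestronglyMeasurable

theorem logPull_logPush (h : ℝ → ℂ) : logPull (logPush h) = h := by
  have hpi := Real.pi_pos
  ext x
  have h1 : √(Real.exp (2 * Real.pi * x)) = Real.exp (Real.pi * x) := by
    rw [← Real.exp_half]
    congr 1
    ring
  rw [logPull, logPush, h1, Real.log_exp, mul_div_cancel_left₀ _ (by positivity),
    mul_inv_cancel_left₀]
  exact_mod_cast (by positivity : √(2 * Real.pi) * Real.exp (Real.pi * x) ≠ 0)

theorem logPush_memLp (h : L2Line) : MemLp (logPush h) 2 (volume.restrict (Ioi 0)) := by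
  refine ⟨?_, by rw [← eLpNorm_logPull, logPull_logPush]; exact Lp.eLpNorm_lt_top h⟩
  have h1 : Measurable (h : ℝ → ℂ) := (Lp.stronglyMeasurable h).measurable
  have h2 : Measurable (logPush h) := by
    unfold logPush
    fun_prop
  exact h2.aestronglyMeasurable

/-- `logPull` as a linear isometry from `L²(0, ∞)` to `L²(ℝ)`. -/
def logPullIsometry : L2Pos →ₗᵢ[ℂ] L2Line where
  toFun f := (logPull_memLp f).toLp (logPull f)
  map_add' f g := by
    rw [← MemLp.toLp_add]
    refine MemLp.toLp_congr _ _ ((logPull_congr (Lp.coeFn_add f g)).trans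
      (Filter.Eventually.of_forall fun x => ?_))
    simp only [logPull, Pi.add_apply, mul_add]
  map_smul' c f := by
    rw [RingHom.id_apply, ← MemLp.toLp_const_smul]
    refine MemLp.toLp_congr _ _ ((logPull_congr (Lp.coeFn_smul c f)).trans
      (Filter.Eventually.of_forall fun x => ?_))
    simp only [logPull, Pi.smul_apply, mul_smul_comm]
  norm_map' f := by
    rw [LinearMap.coe_mk, AddHom.coe_mk, Lp.norm_toLp, eLpNorm_logPull, Lp.norm_def]

theorem logPullIsometry_surjective : Function.Surjective logPullIsometry := by
  intro h
  refine ⟨(logPush_memLp h).toLp _, ?_⟩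
  refine Lp.ext ((MemLp.coeFn_toLp (logPull_memLp _)).trans
    ((logPull_congr (MemLp.coeFn_toLp _)).trans ?_))
  rw [logPull_logPush]

/-- `logPull` as a unitary map from `L²(0, ∞)` onto `L²(ℝ)`. -/
def logPullEquiv : L2Pos ≃ₗᵢ[ℂ] L2Line :=
  LinearIsometryEquiv.ofSurjective logPullIsometry logPullIsometry_surjective

/-- The unitary Mellin transform `Q : L²(0, ∞) → L²(iℝ)`,
`(Q f)(iβ) = (2π)^{-1/2} ∫₀^∞ f(t) t^{iβ - 1/2} dt`. Mathlib's inverse Fourier transform has the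
kernel `e^{2πiβx}`, and `t = e^{2πx}` turns `∫ e^{2πiβx} √(2π) e^{πx} f(e^{2πx}) dx` into the
integral above; see `mellinQ_ae_eq`. -/
def mellinQ : L2Pos ≃ₗᵢ[ℂ] L2Line :=
  logPullEquiv.trans (Lp.fourierTransformₗᵢ ℝ ℂ).symm

open FourierTransform SchwartzMap in
theorem fourierInv_L2_ae_eq (h : L2Line) (hi : Integrable h volume) :
    ((Lp.fourierTransformₗᵢ ℝ ℂ).symm h : ℝ → ℂ) =ᵐ[volume] 𝓕⁻ (h : ℝ → ℂ) := by
  have hc : Continuous (𝓕⁻ (h : ℝ → ℂ)) :=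
    VectorFourier.fourierIntegral_continuous (μ := volume) (L := -innerₗ ℝ)
      (e := Real.fourierChar) Real.continuous_fourierChar (by fun_prop) hi
  refine ae_eq_of_integral_contDiff_smul_eq ((Lp.memLp _).locallyIntegrable (by norm_num))
    hc.locallyIntegrable fun φ hφ hsupp => ?_
  have hsupp' : HasCompactSupport (fun x => (φ x : ℂ)) :=
    hsupp.comp_left (g := fun r : ℝ => (r : ℂ)) (by simp)
  let ψ : 𝓢(ℝ, ℂ) := hsupp'.toSchwartzMap (Complex.ofRealCLM.contDiff.comp hφ)
  have h1 := congrArg (fun T => T ψ) (Lp.fourierInv_toTemperedDistribution_eq h)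
  simp only [TemperedDistribution.fourierInv_apply, Lp.toTemperedDistribution_apply] at h1
  have h2 := VectorFourier.integral_fourierIntegral_smul_eq_flip (μ := volume) (ν := volume)
    (L := -innerₗ ℝ) (e := Real.fourierChar) (f := (ψ : ℝ → ℂ)) (g := (h : ℝ → ℂ))
    Real.continuous_fourierChar (by fun_prop) ψ.integrable hi
  have h3 : (-innerₗ ℝ).flip = -innerₗ ℝ := by
    ext
    simp
  rw [h3] at h2
  have h4 : ∫ x, φ x • ((Lp.fourierTransformₗᵢ ℝ ℂ).symm h) x = ∫ x, ψ x • (𝓕⁻ h : L2Line) x :=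
    integral_congr_ae (Filter.Eventually.of_forall fun x => Complex.real_smul)
  have h5 : ∫ x, φ x • 𝓕⁻ (h : ℝ → ℂ) x = ∫ x, ψ x • 𝓕⁻ (h : ℝ → ℂ) x :=
    integral_congr_ae (Filter.Eventually.of_forall fun x => Complex.real_smul)
  rw [h4, h5, ← h1, SchwartzMap.fourierInv_coe]
  exact h2

theorem integral_Ioi_eq_exp (F : ℝ → ℂ) :
    ∫ t in Ioi 0, F t = ∫ x : ℝ, |2 * Real.pi * Real.exp (2 * Real.pi * x)| •
      F (Real.exp (2 * Real.pi * x)) := by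
  rw [← image_exp_univ, integral_image_eq_integral_abs_deriv_smul MeasurableSet.univ
      hasDerivWithinAt_exp_two_pi injOn_exp_two_pi, Measure.restrict_univ]

theorem integrableOn_Ioi_iff_exp (F : ℝ → ℂ) :
    IntegrableOn F (Ioi 0) ↔ Integrable fun x : ℝ =>
      |2 * Real.pi * Real.exp (2 * Real.pi * x)| • F (Real.exp (2 * Real.pi * x)) := by
  rw [← image_exp_univ, integrableOn_image_iff_integrableOn_abs_deriv_smul MeasurableSet.univ
      hasDerivWithinAt_exp_two_pi injOn_exp_two_pi, integrableOn_univ]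

/-- On the functions for which the Mellin integral converges absolutely, `mellinQ` is given by
it. -/
theorem mellinQ_ae_eq (f : L2Pos)
    (hf : IntegrableOn (fun t : ℝ => f t * ((t : ℂ) ^ (-(1 / 2) : ℂ))) (Ioi 0)) :
    (mellinQ f : ℝ → ℂ) =ᵐ[volume] fun β : ℝ =>
      (1 / (√(2 * Real.pi) : ℂ)) *
        ∫ t in Ioi (0 : ℝ), f t * (t : ℂ) ^ (Complex.I * (β : ℂ) - 1 / 2) := by
  have hpi := Real.pi_pos
  have hs0 : (√(2 * Real.pi) : ℂ) ≠ 0 := by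
    exact_mod_cast (by positivity : √(2 * Real.pi) ≠ 0)
  have hsq : (√(2 * Real.pi) : ℂ) * (√(2 * Real.pi) : ℂ) = 2 * Real.pi := by
    exact_mod_cast Real.mul_self_sqrt (by positivity : (0 : ℝ) ≤ 2 * Real.pi)
  have hpow : ∀ (x : ℝ) (s : ℂ), ((Real.exp (2 * Real.pi * x) : ℝ) : ℂ) ^ s =
      Complex.exp (2 * Real.pi * x * s) := by
    intro x s
    rw [Complex.cpow_def_of_ne_zero (by exact_mod_cast (Real.exp_pos _).ne'),
      ← Complex.ofReal_log (Real.exp_pos _).le, Real.log_exp]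
    push_cast
    rfl
  have hker : ∀ (x : ℝ) (s : ℂ), |2 * Real.pi * Real.exp (2 * Real.pi * x)| •
      (f (Real.exp (2 * Real.pi * x)) * ((Real.exp (2 * Real.pi * x) : ℝ) : ℂ) ^ (s - 1 / 2)) =
      (√(2 * Real.pi) : ℂ) * (Complex.exp (2 * Real.pi * x * s) * logPull f x) := by
    intro x s
    have he : Complex.exp (2 * Real.pi * x) * Complex.exp (2 * Real.pi * x * (s - 1 / 2)) =
        Complex.exp (2 * Real.pi * x * s) * Complex.exp (Real.pi * x) := by
      rw [← Complex.exp_add, ← Complex.exp_add]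
      congr 1
      ring
    rw [abs_of_pos (by positivity), hpow, logPull, Complex.real_smul]
    push_cast
    linear_combination (2 * Real.pi * f (Real.exp (2 * Real.pi * x))) * he -
      Complex.exp (2 * Real.pi * x * s) * Complex.exp (Real.pi * x) *
      f (Real.exp (2 * Real.pi * x)) * hsq
  have hint : Integrable (logPull f) volume := by
    rw [integrableOn_Ioi_iff_exp] at hf
    refine (hf.const_mul (√(2 * Real.pi) : ℂ)⁻¹).congr (Filter.Eventually.of_forall fun x => ?_)
    have := hker x 0
    rw [zero_sub, mul_zero, Complex.exp_zero, one_mul] at this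
    simp only [this]
    rw [inv_mul_cancel_left₀ hs0]
  have hcoe : (logPullEquiv f : ℝ → ℂ) =ᵐ[volume] logPull f :=
    MemLp.coeFn_toLp (logPull_memLp f)
  refine (fourierInv_L2_ae_eq (logPullEquiv f) (hint.congr hcoe.symm)).trans
    (Filter.Eventually.of_forall fun β => ?_)
  simp only
  rw [integral_Ioi_eq_exp]
  simp only [hker]
  rw [integral_const_mul, one_div, inv_mul_cancel_left₀ hs0, Real.fourierInv_eq']
  refine integral_congr_ae ?_
  filter_upwards [hcoe] with x hx
  rw [hx, smul_eq_mul]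
  congr 2
  simp only [RCLike.inner_apply, conj_trivial]
  push_cast
  ring

/-- The operator `M_g` of multiplication by `g ∈ L^∞(iℝ)` on `L²(iℝ)`. -/
def mulOp (g : Lp ℂ ∞ (volume : Measure ℝ)) : L2Line →L[ℂ] L2Line :=
  (ContinuousLinearMap.mul ℂ ℂ).holderL volume ∞ 2 2 g

/-- The operator `Q⁻¹ M_g Q` on `L²(0, ∞)`. -/
def mellinMultiplier (g : Lp ℂ ∞ (volume : Measure ℝ)) : L2Pos →L[ℂ] L2Pos :=
  (mellinQ.symm : L2Line →L[ℂ] L2Pos) ∘L mulOp g ∘L (mellinQ : L2Pos →L[ℂ] L2Line)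

/-- The truncated inner integral `∫_{1/R}^R f(u) u^{iy - 1/2} du`. -/
def innerTrunc (f : ℝ → ℂ) (R y : ℝ) : ℂ :=
  ∫ u in Icc R⁻¹ R, f u * (u : ℂ) ^ (Complex.I * (y : ℂ) - 1 / 2)

/-- The truncated outer integral `(1 / 2π) ∫_{-R}^R t^{-iy - 1/2} G(iy) dy`. -/
def outerTrunc (G : ℝ → ℂ) (R t : ℝ) : ℂ :=
  (1 / (2 * (Real.pi : ℂ))) *
    ∫ y in Icc (-R) R, (t : ℂ) ^ (-(Complex.I * (y : ℂ)) - 1 / 2) * G y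

/-- `h ∈ L²(0, ∞)` is the double integral
`h(t) = (1 / 2π) ∫_{-∞}^∞ t^{-iy - 1/2} g(iy) (∫₀^∞ f(u) u^{iy - 1/2} du) dy`.
For general `f ∈ L²(0, ∞)` neither integral converges absolutely; as usual for the Mellin and
Fourier transforms on `L²`, both are limits in the mean of the truncated integrals. -/
def IsMellinDoubleIntegral (g : Lp ℂ ∞ (volume : Measure ℝ)) (f h : L2Pos) : Prop :=
  ∃ F : L2Line,
    Filter.Tendsto (fun R : ℝ => eLpNorm (fun y => innerTrunc f R y - F y) 2 volume)
      Filter.atTop (𝓝 0) ∧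
    Filter.Tendsto (fun R : ℝ => eLpNorm (fun t => outerTrunc (fun y => g y * F y) R t - h t) 2
      (volume.restrict (Ioi 0))) Filter.atTop (𝓝 0)

end

end HardyMellin

open HardyMellin

/-! The Mellin transform diagonalizes the Hardy operator: `mellinQ_hardyInfty` shows that Q H_∞ Q⁻¹
is multiplication by h(y) = 1/(1/2 - iy). It suffices to compare the two sides on the indicators of
(0, a], whose span is dense. Any multiplier Q⁻¹ M_g Q therefore commutes with H_∞.

Conversely, let A commute with H_∞, so that T = Q A Q⁻¹ commutes with M_h. The function u = h - 1 =
(1/2 + iy)/(1/2 - iy) is unimodular and injective. Unimodularity makes T commute with the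
multiplication by conj u as well, and injectivity makes the resulting star algebra of bounded
continuous functions separate points. Such an algebra determines finite Borel measures on a Polish
space. Hence (T f) conj k = f conj(T† k) a.e. for all f and k in L²
(`CommutesWithMul.mul_conj_ae_eq`). A nowhere vanishing k exhibits T as a multiplication, by a
function that is bounded because T is (`exists_mul_of_commutesWithMul`).

The double integral is a matter of uniqueness of L² limits: its truncations are Q and Q⁻¹, up to the
reciprocal factors √(2π) and 1/√(2π), applied to functions cut off to an interval, and the cut-offs
converge in L² (`isMellinDoubleIntegral_iff`). -/

namespace HardyMellin

open scoped BoundedContinuousFunction ComplexConjugate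
open BoundedContinuousFunction

/-! ### Operators on L² that commute with multiplications -/

section Multiplication

variable {E : Type*} [MeasurableSpace E] {μ : Measure E}

/-- `T` commutes with multiplication by `g`. -/
def CommutesWithMul (T : Lp ℂ 2 μ →L[ℂ] Lp ℂ 2 μ) (g : E → ℂ) : Prop :=
  ∀ f f' : Lp ℂ 2 μ, (f' =ᵐ[μ] fun x => g x * f x) → T f' =ᵐ[μ] fun x => g x * T f x

theorem CommutesWithMul.const (T : Lp ℂ 2 μ →L[ℂ] Lp ℂ 2 μ) (c : ℂ) :
    CommutesWithMul T fun _ => c := by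
  intro f f' hf
  have h : f' = c • f := Lp.ext (hf.trans (Lp.coeFn_smul c f).symm)
  rw [h, map_smul]
  exact Lp.coeFn_smul c (T f)

/-- For a unimodular function, commuting with the multiplication by it implies commuting with
the adjoint of this multiplication. -/
theorem CommutesWithMul.conj_of_norm_eq_one {T : Lp ℂ 2 μ →L[ℂ] Lp ℂ 2 μ} {u : E → ℂ}
    (hu : ∀ x, ‖u x‖ = 1) (h : CommutesWithMul T u) : CommutesWithMul T fun x => conj (u x) := by
  have hu' : ∀ x, conj (u x) * u x = 1 := fun x => by
    rw [mul_comm, Complex.mul_conj, Complex.normSq_eq_norm_sq, hu]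
    simp
  intro f f' hf
  -- Since conj u inverts u, the hypothesis applies to the pair with its roles exchanged.
  have h1 : f =ᵐ[μ] fun x => u x * f' x := by
    filter_upwards [hf] with x hx
    rw [hx, ← mul_assoc, mul_comm (u x), hu', one_mul]
  filter_upwards [h _ _ h1] with x hx
  rw [hx, ← mul_assoc, hu', one_mul]

/-- Testing T on the indicator of a set s of finite measure gives ∫_s |G|² ≤ ‖T‖² μ(s), and by
σ-finiteness these inequalities bound |G|² almost everywhere. -/
theorem ae_enorm_le_of_mul_eq [SigmaFinite μ] (T : Lp ℂ 2 μ →L[ℂ] Lp ℂ 2 μ) {G : E → ℂ}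
    (hG : Measurable G) (h : ∀ f : Lp ℂ 2 μ, T f =ᵐ[μ] fun x => G x * f x) :
    ∀ᵐ x ∂μ, ‖G x‖ₑ ≤ ‖T‖ₑ := by
  have h1 : (fun x => ‖G x‖ₑ ^ 2) ≤ᵐ[μ] fun _ => ‖T‖ₑ ^ 2 := by
    refine ae_le_of_forall_setLIntegral_le_of_sigmaFinite (by fun_prop) fun s hs hμs => ?_
    have h2 := T.le_opENorm (indicatorConstLp 2 hs hμs.ne (1 : ℂ))
    rw [Lp.enorm_def, Lp.enorm_def, eLpNorm_congr_ae (h _),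
      eLpNorm_congr_ae indicatorConstLp_coeFn,
      eLpNorm_indicator_const hs (by norm_num) (by norm_num), eLpNorm_two_eq] at h2
    have h3 := pow_le_pow_left₀ zero_le h2 2
    rw [mul_pow, ← ENNReal.rpow_mul_natCast, enorm_one, one_mul, ← ENNReal.rpow_mul_natCast] at h3
    norm_num at h3
    rw [setLIntegral_const]
    refine le_trans (le_of_eq ?_) h3
    rw [← lintegral_indicator hs]
    refine lintegral_congr_ae ?_
    filter_upwards [indicatorConstLp_coeFn (p := 2) (hs := hs) (hμs := hμs.ne) (c := (1 : ℂ))]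
      with x hx
    rw [hx]
    by_cases hxs : x ∈ s <;> simp [hxs]
  filter_upwards [h1] with x hx
  exact (ENNReal.pow_le_pow_left_iff two_ne_zero).mp hx

/-- A substitute for the constant 1, which is not in L² when μ is infinite: the square root of a
strictly positive integrable function. -/
theorem exists_Lp_two_ae_ne_zero (μ : Measure E) [SigmaFinite μ] :
    ∃ w : Lp ℂ 2 μ, ∀ᵐ x ∂μ, w x ≠ 0 := by
  obtain ⟨v, hv0, hvm, hv⟩ := exists_pos_lintegral_lt_of_sigmaFinite μ one_ne_zero
  have hmem : MemLp (fun x => ((√(v x : ℝ) : ℝ) : ℂ)) 2 μ := by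
    refine ⟨by fun_prop, ?_⟩
    rw [eLpNorm_two_eq]
    refine ENNReal.rpow_lt_top_of_nonneg (by norm_num) (ne_of_lt (lt_of_le_of_lt ?_
      (hv.trans ENNReal.one_lt_top)))
    refine lintegral_mono fun x => ?_
    rw [← ofReal_norm, Complex.norm_real, Real.norm_of_nonneg (Real.sqrt_nonneg _),
      ← ENNReal.ofReal_pow (Real.sqrt_nonneg _), Real.sq_sqrt (v x).coe_nonneg, ENNReal.ofReal_coe_nnreal]
  refine ⟨hmem.toLp _, ?_⟩
  filter_upwards [hmem.coeFn_toLp] with x hx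
  rw [hx]
  exact_mod_cast (Real.sqrt_pos.mpr (hv0 x)).ne'

section BoundedContinuous

variable [TopologicalSpace E] [BorelSpace E]

theorem memLp_boundedContinuous_mul (g : E →ᵇ ℂ) (f : Lp ℂ 2 μ) :
    MemLp (fun x => g x * f x) 2 μ :=
  (Lp.memLp f).mul (memLp_top_of_bound g.continuous.measurable.aestronglyMeasurable ‖g‖
    (Filter.Eventually.of_forall fun x => g.norm_coe_le_norm x))

theorem CommutesWithMul.add {T : Lp ℂ 2 μ →L[ℂ] Lp ℂ 2 μ} {g g' : E →ᵇ ℂ}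
    (hg : CommutesWithMul T g) (hg' : CommutesWithMul T g') :
    CommutesWithMul T (g + g' : E →ᵇ ℂ) := by
  intro f f' hf
  have h1 := (memLp_boundedContinuous_mul g f).coeFn_toLp
  have h2 := (memLp_boundedContinuous_mul g' f).coeFn_toLp
  have h : f' = (memLp_boundedContinuous_mul g f).toLp _ +
      (memLp_boundedContinuous_mul g' f).toLp _ := by
    refine Lp.ext ?_
    filter_upwards [hf, h1, h2, Lp.coeFn_add ((memLp_boundedContinuous_mul g f).toLp _)
      ((memLp_boundedContinuous_mul g' f).toLp _)] with x h1 h2 h3 h4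
    rw [h1, h4, Pi.add_apply, h2, h3, coe_add, Pi.add_apply, add_mul]
  rw [h, map_add]
  filter_upwards [hg _ _ h1, hg' _ _ h2, Lp.coeFn_add (T ((memLp_boundedContinuous_mul g f).toLp _))
      (T ((memLp_boundedContinuous_mul g' f).toLp _))] with x h1 h2 h3
  rw [h3, Pi.add_apply, h1, h2, coe_add, Pi.add_apply, add_mul]

theorem CommutesWithMul.mul {T : Lp ℂ 2 μ →L[ℂ] Lp ℂ 2 μ} {g g' : E →ᵇ ℂ}
    (hg : CommutesWithMul T g) (hg' : CommutesWithMul T g') :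
    CommutesWithMul T (g * g' : E →ᵇ ℂ) := by
  intro f f' hf
  have h2 := (memLp_boundedContinuous_mul g' f).coeFn_toLp
  have h1 : f' =ᵐ[μ] fun x => g x * (memLp_boundedContinuous_mul g' f).toLp _ x := by
    filter_upwards [hf, h2] with x h1 h2
    rw [h1, h2, coe_mul, Pi.mul_apply, mul_assoc]
  filter_upwards [hg _ _ h1, hg' _ _ h2] with x h1 h2
  rw [h1, h2, coe_mul, Pi.mul_apply, mul_assoc]

/-- The bounded continuous functions `g` such that `T` commutes with the multiplications by `g`
and by its conjugate. -/
def mulCommutant (T : Lp ℂ 2 μ →L[ℂ] Lp ℂ 2 μ) : StarSubalgebra ℂ (E →ᵇ ℂ) where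
  carrier := {g | CommutesWithMul T g ∧ CommutesWithMul T (star g : E →ᵇ ℂ)}
  mul_mem' ha hb := ⟨ha.1.mul hb.1, by rw [star_mul]; exact hb.2.mul ha.2⟩
  add_mem' ha hb := ⟨ha.1.add hb.1, by rw [star_add]; exact ha.2.add hb.2⟩
  algebraMap_mem' c := ⟨CommutesWithMul.const T c, CommutesWithMul.const T (star c)⟩
  star_mem' ha := ⟨ha.2, by rw [star_star]; exact ha.1⟩

end BoundedContinuous

end Multiplication

/-! ### The commutant of a point-separating algebra of multiplications -/

section Commutant

variable {E : Type*} [TopologicalSpace E] [PolishSpace E] [MeasurableSpace E] [BorelSpace E]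
  {μ : Measure E}

/-- The measures k⁺ μ and k⁻ μ are finite and give the same integrals on S. A point-separating star
algebra determines finite measures on a Polish space, so k⁺ = k⁻ a.e. -/
theorem ae_eq_zero_of_forall_integral_starSubalgebra_real [SigmaFinite μ]
    {S : StarSubalgebra ℂ (E →ᵇ ℂ)} (hS : (S.map (toContinuousMapStarₐ ℂ)).SeparatesPoints)
    {k : E → ℝ} (hk : Integrable k μ) (h0 : ∀ g ∈ S, ∫ x, g x * (k x : ℂ) ∂μ = 0) :
    k =ᵐ[μ] 0 := by
  have hm : AEMeasurable (fun x => ENNReal.ofReal (k x)) μ := hk.aemeasurable.ennreal_ofReal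
  have hm' : AEMeasurable (fun x => ENNReal.ofReal (-k x)) μ := hk.aemeasurable.neg.ennreal_ofReal
  have hfin : IsFiniteMeasure (μ.withDensity fun x => ENNReal.ofReal (k x)) :=
    isFiniteMeasure_withDensity_ofReal hk.2
  have hfin' : IsFiniteMeasure (μ.withDensity fun x => ENNReal.ofReal (-k x)) :=
    isFiniteMeasure_withDensity_ofReal hk.neg.2
  have hI : ∀ (g : E →ᵇ ℂ) {j : E → ℝ}, Integrable j μ → Integrable (fun x => g x * (j x : ℂ)) μ :=
    fun g j hj => hj.ofReal.bdd_mul (c := ‖g‖) g.continuous.measurable.aestronglyMeasurable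
      (Filter.Eventually.of_forall fun x => g.norm_coe_le_norm x)
  have hpm : ∀ x, k x = max (k x) 0 - max (-k x) 0 := fun x => by
    rcases le_total 0 (k x) with h | h <;> simp [h]
  have h := ext_of_forall_mem_subalgebra_integral_eq_of_polish hS
    (P := μ.withDensity fun x => ENNReal.ofReal (k x))
    (P' := μ.withDensity fun x => ENNReal.ofReal (-k x)) fun g hg => by
      rw [integral_withDensity_eq_integral_toReal_smul₀ hm (by simp),
        integral_withDensity_eq_integral_toReal_smul₀ hm' (by simp), ← sub_eq_zero, ← h0 g hg]
      simp only [ENNReal.toReal_ofReal', Complex.real_smul]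
      rw [← integral_sub]
      · refine integral_congr_ae (Filter.Eventually.of_forall fun x => ?_)
        have := congrArg (fun r : ℝ => (r : ℂ)) (hpm x)
        simp only [Complex.ofReal_sub] at this
        simp only [this]
        ring
      · simpa only [mul_comm] using hI g hk.pos_part
      · simpa only [mul_comm] using hI g hk.neg_part
  rw [withDensity_eq_iff_of_sigmaFinite hm hm'] at h
  filter_upwards [h] with x hx
  have := congrArg ENNReal.toReal hx
  rw [ENNReal.toReal_ofReal', ENNReal.toReal_ofReal'] at this
  have h2 := hpm x
  rw [this, sub_self] at h2
  exact h2

/-- As S is closed under conjugation, it annihilates conj k along with k, hence the real and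
imaginary parts of k, to which the real case applies. -/
theorem ae_eq_zero_of_forall_integral_starSubalgebra [SigmaFinite μ]
    {S : StarSubalgebra ℂ (E →ᵇ ℂ)} (hS : (S.map (toContinuousMapStarₐ ℂ)).SeparatesPoints)
    {k : E → ℂ} (hk : Integrable k μ) (h0 : ∀ g ∈ S, ∫ x, g x * k x ∂μ = 0) :
    k =ᵐ[μ] 0 := by
  have hI : ∀ (g : E →ᵇ ℂ) {j : E → ℂ}, Integrable j μ → Integrable (fun x => g x * j x) μ :=
    fun g j hj => hj.bdd_mul (c := ‖g‖) g.continuous.measurable.aestronglyMeasurable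
      (Filter.Eventually.of_forall fun x => g.norm_coe_le_norm x)
  have hk' : Integrable (fun x => conj (k x)) μ :=
    (Complex.conjCLE.toContinuousLinearMap.integrable_comp hk)
  have h0' : ∀ g ∈ S, ∫ x, g x * conj (k x) ∂μ = 0 := fun g hg => by
    have h1 := congrArg conj (h0 (star g) (star_mem hg))
    rw [← integral_conj, map_zero] at h1
    simpa using h1
  have hre := ae_eq_zero_of_forall_integral_starSubalgebra_real hS hk.re fun g hg => by
    have h1 : ∀ x, g x * ((RCLike.re (k x) : ℝ) : ℂ) =
        (1 / 2) * (g x * k x + g x * conj (k x)) := fun x => by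
      rw [← mul_add, Complex.add_conj]
      simp only [RCLike.re_eq_complex_re]
      push_cast
      ring
    simp only [h1]
    rw [integral_const_mul, integral_add (hI g hk) (hI g hk'), h0 g hg, h0' g hg]
    simp
  have him := ae_eq_zero_of_forall_integral_starSubalgebra_real hS hk.im fun g hg => by
    have h1 : ∀ x, g x * ((RCLike.im (k x) : ℝ) : ℂ) =
        (-Complex.I / 2) * (g x * k x - g x * conj (k x)) := fun x => by
      rw [← mul_sub, Complex.sub_conj]
      simp only [RCLike.im_eq_complex_im]
      push_cast
      linear_combination (g x * (k x).im) * Complex.I_sq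
    simp only [h1]
    rw [integral_const_mul, integral_sub (hI g hk) (hI g hk'), h0 g hg, h0' g hg]
    simp
  filter_upwards [hre, him] with x h1 h2
  exact Complex.ext h1 h2

/-- An operator commuting with a separating family of multiplications is formally a
multiplication: `(T f) * conj h = f * conj (T† h)`. -/
theorem CommutesWithMul.mul_conj_ae_eq [SigmaFinite μ] {T : Lp ℂ 2 μ →L[ℂ] Lp ℂ 2 μ}
    {S : StarSubalgebra ℂ (E →ᵇ ℂ)} (hS : (S.map (toContinuousMapStarₐ ℂ)).SeparatesPoints)
    (hT : ∀ g ∈ S, CommutesWithMul T g) (f h : Lp ℂ 2 μ) :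
    (fun x => T f x * conj (h x)) =ᵐ[μ] fun x => f x * conj (T.adjoint h x) := by
  have hint : ∀ a b : Lp ℂ 2 μ, Integrable (fun x => a x * conj (b x)) μ := fun a b => by
    simpa [RCLike.inner_apply] using L2.integrable_inner (𝕜 := ℂ) b a
  have hI : ∀ (g : E →ᵇ ℂ) {j : E → ℂ}, Integrable j μ → Integrable (fun x => g x * j x) μ :=
    fun g j hj => hj.bdd_mul (c := ‖g‖) g.continuous.measurable.aestronglyMeasurable
      (Filter.Eventually.of_forall fun x => g.norm_coe_le_norm x)
  have key := ae_eq_zero_of_forall_integral_starSubalgebra hS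
    ((hint (T f) h).sub (hint f (T.adjoint h))) fun g hg => by
      simp only [Pi.sub_apply, mul_sub]
      rw [integral_sub (hI g (hint _ _)) (hI g (hint _ _)), sub_eq_zero]
      have h1 := (memLp_boundedContinuous_mul g f).coeFn_toLp
      have h2 := hT g hg _ _ h1
      -- Moving T across the inner product gives ∫ T(g f) conj h = ∫ g f conj(T† h), and T(g f) = g
      -- T f.
      have h3 := T.adjoint_inner_left ((memLp_boundedContinuous_mul g f).toLp _) h
      rw [L2.inner_def, L2.inner_def] at h3
      simp only [RCLike.inner_apply] at h3
      refine Eq.trans ?_ (h3.symm.trans ?_)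
      · refine integral_congr_ae ?_
        filter_upwards [h2] with x hx
        rw [hx, mul_assoc]
      · refine integral_congr_ae ?_
        filter_upwards [h1] with x hx
        rw [hx, mul_assoc]
  filter_upwards [key] with x hx
  exact sub_eq_zero.mp hx

/-- Dividing the identity of `CommutesWithMul.mul_conj_ae_eq` by conj w, for a w that vanishes
almost nowhere, leaves a multiplier that does not depend on f. -/
theorem exists_mul_of_commutesWithMul [SigmaFinite μ] {T : Lp ℂ 2 μ →L[ℂ] Lp ℂ 2 μ}
    {S : StarSubalgebra ℂ (E →ᵇ ℂ)} (hS : (S.map (toContinuousMapStarₐ ℂ)).SeparatesPoints)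
    (hT : ∀ g ∈ S, CommutesWithMul T g) :
    ∃ G : Lp ℂ ∞ μ, ∀ f : Lp ℂ 2 μ, T f =ᵐ[μ] fun x => G x * f x := by
  obtain ⟨w, hw⟩ := exists_Lp_two_ae_ne_zero μ
  set G : E → ℂ := fun x => conj (T.adjoint w x) / conj (w x) with hGdef
  have hG : Measurable G := by
    have h1 := (Lp.stronglyMeasurable w).measurable
    have h2 := (Lp.stronglyMeasurable (T.adjoint w)).measurable
    have h3 : Measurable (conj : ℂ → ℂ) := Complex.continuous_conj.measurable
    exact (h3.comp h2).div (h3.comp h1)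
  have hmul : ∀ f : Lp ℂ 2 μ, T f =ᵐ[μ] fun x => G x * f x := fun f => by
    filter_upwards [CommutesWithMul.mul_conj_ae_eq hS hT f w, hw] with x hx hx0
    have : conj (w x) ≠ 0 := by simpa using hx0
    rw [hGdef, div_mul_eq_mul_div, eq_div_iff this, hx, mul_comm]
  have hmem : MemLp G ∞ μ := memLp_top_of_bound hG.aestronglyMeasurable ‖T‖ (by
    filter_upwards [ae_enorm_le_of_mul_eq T hG hmul] with x hx
    exact enorm_le_iff_norm_le.mp hx)
  refine ⟨hmem.toLp G, fun f => ?_⟩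
  filter_upwards [hmul f, hmem.coeFn_toLp] with x h1 h2
  rw [h1, h2]

end Commutant

/-! ### Limits in the mean of truncated functions -/

section LimitInMean

variable {E : Type*} [MeasurableSpace E] {μ : Measure E}

/-- Passes from pointwise formulas to the Hilbert space, where isometries and uniqueness of limits
are available. Representing `F` only eventually is enough, as is needed for truncations to [1/R, R]
with R > 0. -/
theorem tendsto_eLpNorm_sub_iff {ι : Type*} {l : Filter ι} {F : ι → E → ℂ} {F' : ι → Lp ℂ 2 μ}
    (h : ∀ᶠ i in l, F' i =ᵐ[μ] F i) {G : E → ℂ} {G' : Lp ℂ 2 μ} (hG : G' =ᵐ[μ] G) :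
    Filter.Tendsto (fun i => eLpNorm (fun x => F i x - G x) 2 μ) l (𝓝 0) ↔
      Filter.Tendsto F' l (𝓝 G') := by
  rw [Lp.tendsto_Lp_iff_tendsto_eLpNorm']
  refine Filter.tendsto_congr' ?_
  filter_upwards [h] with i hi
  exact eLpNorm_congr_ae (hi.symm.sub hG.symm)

/-- The restriction of an `L²` function to a measurable set, extended by zero. -/
noncomputable def indicatorLp {s : Set E} (hs : MeasurableSet s) (f : Lp ℂ 2 μ) : Lp ℂ 2 μ :=
  ((Lp.memLp f).indicator hs).toLp (s.indicator f)

theorem indicatorLp_coeFn {s : Set E} (hs : MeasurableSet s) (f : Lp ℂ 2 μ) :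
    indicatorLp hs f =ᵐ[μ] s.indicator f :=
  MemLp.coeFn_toLp _

/-- Dominated convergence, with |f|² as the dominating function. -/
theorem tendsto_indicatorLp {s : ℝ → Set E} (hs : ∀ R, MeasurableSet (s R)) (f : Lp ℂ 2 μ)
    (hmem : ∀ᵐ x ∂μ, ∀ᶠ R in Filter.atTop, x ∈ s R) :
    Filter.Tendsto (fun R => indicatorLp (hs R) f) Filter.atTop (𝓝 f) := by
  rw [← tendsto_eLpNorm_sub_iff (F := fun R => (s R).indicator f)
    (Filter.Eventually.of_forall fun R => indicatorLp_coeFn (hs R) f) (Filter.EventuallyEq.refl _ _)]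
  simp only [eLpNorm_two_eq]
  have h0 : (0 : ℝ≥0∞) = (0 : ℝ≥0∞) ^ (1 / 2 : ℝ) := by
    rw [ENNReal.zero_rpow_of_pos (by norm_num)]
  conv => rw [h0]
  refine (ENNReal.continuous_rpow_const.tendsto _).comp ?_
  have hfm : Measurable (f : E → ℂ) := (Lp.stronglyMeasurable f).measurable
  rw [show (0 : ℝ≥0∞) = ∫⁻ _, 0 ∂μ by simp]
  refine tendsto_lintegral_filter_of_dominated_convergence (fun x => ‖f x‖ₑ ^ 2)
    (Filter.Eventually.of_forall fun R => ?_) (Filter.Eventually.of_forall fun R =>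
      Filter.Eventually.of_forall fun x => ?_) ?_ ?_
  · exact ((hfm.indicator (hs R)).sub hfm).enorm.pow_const 2
  · by_cases hx : x ∈ s R <;> simp [hx]
  · have h1 := Lp.eLpNorm_lt_top f
    rw [eLpNorm_two_eq] at h1
    exact ((ENNReal.rpow_lt_top_iff_of_pos (by norm_num)).mp h1).ne
  · filter_upwards [hmem] with x hx
    refine tendsto_const_nhds.congr' ?_
    filter_upwards [hx] with R hR
    simp [hR]

end LimitInMean

/-! ### The truncated Mellin integrals and their limits -/

-- Tested against a smooth compactly supported φ, both sides give ∫ φ̂ h: the left by the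
-- distributional definition, the right by Fubini.
open FourierTransform SchwartzMap in
theorem fourier_L2_ae_eq (h : L2Line) (hi : Integrable h volume) :
    (Lp.fourierTransformₗᵢ ℝ ℂ h : ℝ → ℂ) =ᵐ[volume] 𝓕 (h : ℝ → ℂ) := by
  have hc : Continuous (𝓕 (h : ℝ → ℂ)) :=
    VectorFourier.fourierIntegral_continuous (μ := volume) (L := innerₗ ℝ)
      (e := Real.fourierChar) Real.continuous_fourierChar (by fun_prop) hi
  refine ae_eq_of_integral_contDiff_smul_eq ((Lp.memLp _).locallyIntegrable (by norm_num))
    hc.locallyIntegrable fun φ hφ hsupp => ?_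
  have hsupp' : HasCompactSupport (fun x => (φ x : ℂ)) :=
    hsupp.comp_left (g := fun r : ℝ => (r : ℂ)) (by simp)
  let ψ : 𝓢(ℝ, ℂ) := hsupp'.toSchwartzMap (Complex.ofRealCLM.contDiff.comp hφ)
  have h1 := congrArg (fun T => T ψ) (Lp.fourier_toTemperedDistribution_eq h)
  simp only [TemperedDistribution.fourier_apply, Lp.toTemperedDistribution_apply] at h1
  have h2 := VectorFourier.integral_fourierIntegral_smul_eq_flip (μ := volume) (ν := volume)
    (L := innerₗ ℝ) (e := Real.fourierChar) (f := (ψ : ℝ → ℂ)) (g := (h : ℝ → ℂ))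
    Real.continuous_fourierChar (by fun_prop) ψ.integrable hi
  rw [flip_innerₗ] at h2
  have h4 : ∫ x, φ x • (Lp.fourierTransformₗᵢ ℝ ℂ h) x = ∫ x, ψ x • (𝓕 h : L2Line) x :=
    integral_congr_ae (Filter.Eventually.of_forall fun x => Complex.real_smul)
  have h5 : ∫ x, φ x • 𝓕 (h : ℝ → ℂ) x = ∫ x, ψ x • 𝓕 (h : ℝ → ℂ) x :=
    integral_congr_ae (Filter.Eventually.of_forall fun x => Complex.real_smul)
  rw [h4, h5, ← h1, SchwartzMap.fourier_coe]
  exact h2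

theorem sqrt_two_pi_ne_zero : (√(2 * Real.pi) : ℂ) ≠ 0 := by
  have hpi := Real.pi_pos
  exact_mod_cast (by positivity : √(2 * Real.pi) ≠ 0)

theorem exp_two_pi_cpow (x : ℝ) (s : ℂ) :
    ((Real.exp (2 * Real.pi * x) : ℝ) : ℂ) ^ s = Complex.exp (2 * Real.pi * x * s) := by
  rw [Complex.cpow_def_of_ne_zero (by exact_mod_cast (Real.exp_pos _).ne'),
    ← Complex.ofReal_log (Real.exp_pos _).le, Real.log_exp]
  push_cast
  rfl

theorem integrableOn_Icc_mul_cpow (f : L2Pos) {R : ℝ} (hR : 0 < R) (s : ℂ) :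
    IntegrableOn (fun t : ℝ => f t * (t : ℂ) ^ s) (Icc R⁻¹ R) := by
  have hpos : ∀ t ∈ Icc R⁻¹ R, 0 < t := fun t ht => (inv_pos.mpr hR).trans_le ht.1
  have h : MemLp f 2 (volume.restrict (Icc R⁻¹ R)) :=
    (Lp.memLp f).mono_measure (Measure.restrict_mono hpos le_rfl)
  refine IntegrableOn.mul_continuousOn (h.integrable (by norm_num)) ?_ isCompact_Icc
  intro t ht
  exact (Complex.continuousAt_ofReal_cpow_const t s (Or.inr (hpos t ht).ne')).continuousWithinAt

/-- On [1/R, R] the kernel is bounded and f is integrable, so the absolutely convergent formula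
`mellinQ_ae_eq` applies to the cut-off of f. -/
theorem innerTrunc_ae_eq (f : L2Pos) {R : ℝ} (hR : 0 < R) :
    ((√(2 * Real.pi) : ℂ) • mellinQ (indicatorLp (measurableSet_Icc (a := R⁻¹) (b := R)) f) : L2Line)
      =ᵐ[volume] innerTrunc f R := by
  have hsub : Icc R⁻¹ R ⊆ Ioi 0 := fun t ht => (inv_pos.mpr hR).trans_le ht.1
  have hae : ∀ s : ℂ, (fun t : ℝ => indicatorLp (measurableSet_Icc (a := R⁻¹) (b := R)) f t *
      (t : ℂ) ^ s) =ᵐ[volume.restrict (Ioi 0)]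
      (Icc R⁻¹ R).indicator fun t : ℝ => f t * (t : ℂ) ^ s := fun s => by
    filter_upwards [indicatorLp_coeFn (measurableSet_Icc (a := R⁻¹) (b := R)) f] with t ht
    rw [ht]
    by_cases h : t ∈ Icc R⁻¹ R <;> simp only [h, indicator_of_mem, indicator_of_notMem,
      not_false_eq_true, zero_mul]
  have h1 := mellinQ_ae_eq (indicatorLp (measurableSet_Icc (a := R⁻¹) (b := R)) f) (by
    refine Integrable.congr ?_ (hae _).symm
    exact ((integrableOn_Icc_mul_cpow f hR _).integrable_indicator measurableSet_Icc).restrict)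
  filter_upwards [h1, Lp.coeFn_smul (√(2 * Real.pi) : ℂ)
    (mellinQ (indicatorLp (measurableSet_Icc (a := R⁻¹) (b := R)) f))] with y hy hy'
  rw [hy', Pi.smul_apply, hy, smul_eq_mul, one_div, mul_inv_cancel_left₀ sqrt_two_pi_ne_zero,
    integral_congr_ae (hae _), setIntegral_indicator measurableSet_Icc,
    inter_eq_self_of_subset_right hsub, innerTrunc]

theorem tendsto_innerTrunc_iff (f : L2Pos) (F : L2Line) :
    Filter.Tendsto (fun R : ℝ => eLpNorm (fun y => innerTrunc f R y - F y) 2 volume)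
      Filter.atTop (𝓝 0) ↔ F = (√(2 * Real.pi) : ℂ) • mellinQ f := by
  have hlim : Filter.Tendsto (fun R : ℝ => (√(2 * Real.pi) : ℂ) •
      mellinQ (indicatorLp (measurableSet_Icc (a := R⁻¹) (b := R)) f)) Filter.atTop
      (𝓝 ((√(2 * Real.pi) : ℂ) • mellinQ f)) := by
    refine ((mellinQ.continuous.tendsto f).comp (tendsto_indicatorLp
      (s := fun R : ℝ => Icc R⁻¹ R) (fun R => measurableSet_Icc) f ?_)).const_smul _
    filter_upwards [ae_restrict_mem measurableSet_Ioi] with x hx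
    filter_upwards [Filter.eventually_ge_atTop x, tendsto_inv_atTop_zero.eventually_le_const hx]
      with R h1 h2
    exact ⟨h2, h1⟩
  rw [tendsto_eLpNorm_sub_iff (F' := fun R : ℝ => (√(2 * Real.pi) : ℂ) •
      mellinQ (indicatorLp (measurableSet_Icc (a := R⁻¹) (b := R)) f))
    ((Filter.eventually_gt_atTop 0).mono fun R hR => innerTrunc_ae_eq f hR)
    (Filter.EventuallyEq.refl _ _)]
  exact ⟨fun h => tendsto_nhds_unique h hlim, fun h => h ▸ hlim⟩

/-- For t = e^{2πx} the kernel t^{-iy-1/2} is e^{-πx} e^{-2πixy}. The factor e^{-πx} cancels the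
e^{πx} of `logPull`, and √(2π)/(2π) is the constant on the left. -/
theorem logPull_outerTrunc_ae_eq {G : ℝ → ℂ} {K : L2Line} (hK : K =ᵐ[volume] G) (R : ℝ) :
    ((√(2 * Real.pi) : ℂ)⁻¹ • Lp.fourierTransformₗᵢ ℝ ℂ
      (indicatorLp (measurableSet_Icc (a := -R) (b := R)) K) : L2Line) =ᵐ[volume]
      logPull (outerTrunc G R) := by
  have hpi := Real.pi_pos
  have hs := sqrt_two_pi_ne_zero
  have hsq : (√(2 * Real.pi) : ℂ) * (√(2 * Real.pi) : ℂ) = 2 * Real.pi := by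
    exact_mod_cast Real.mul_self_sqrt (by positivity : (0 : ℝ) ≤ 2 * Real.pi)
  have hcoe : indicatorLp (measurableSet_Icc (a := -R) (b := R)) K =ᵐ[volume]
      (Icc (-R) R).indicator G := by
    filter_upwards [indicatorLp_coeFn (measurableSet_Icc (a := -R) (b := R)) K, hK] with y h1 h2
    rw [h1]
    by_cases h : y ∈ Icc (-R) R <;> simp only [h, indicator_of_mem, indicator_of_notMem,
      not_false_eq_true, h2]
  have hint : Integrable (indicatorLp (measurableSet_Icc (a := -R) (b := R)) K) volume := by
    have h : MemLp K 2 (volume.restrict (Icc (-R) R)) := (Lp.memLp K).restrict _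
    have h1 : IntegrableOn K (Icc (-R) R) := h.integrable (by norm_num)
    exact (h1.integrable_indicator measurableSet_Icc).congr (indicatorLp_coeFn _ K).symm
  filter_upwards [fourier_L2_ae_eq _ hint, Lp.coeFn_smul (√(2 * Real.pi) : ℂ)⁻¹
    (Lp.fourierTransformₗᵢ ℝ ℂ (indicatorLp (measurableSet_Icc (a := -R) (b := R)) K))] with x h1 h2
  rw [h2, Pi.smul_apply, h1, Real.fourier_eq', logPull, outerTrunc]
  have h3 : ∀ y : ℝ, ((Real.exp (2 * Real.pi * x) : ℝ) : ℂ) ^ (-(Complex.I * (y : ℂ)) - 1 / 2) *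
      G y = Complex.exp (-(Real.pi * x)) *
        (Complex.exp (((-2 * Real.pi * inner ℝ y x : ℝ) : ℂ) * Complex.I) * G y) := fun y => by
    rw [exp_two_pi_cpow, ← mul_assoc, ← Complex.exp_add]
    congr 2
    simp only [RCLike.inner_apply, conj_trivial]
    push_cast
    ring
  simp only [h3, smul_eq_mul]
  rw [integral_const_mul, ← integral_indicator measurableSet_Icc]
  have h4 : ∫ y : ℝ, Complex.exp (((-2 * Real.pi * inner ℝ y x : ℝ) : ℂ) * Complex.I) *
      (indicatorLp (measurableSet_Icc (a := -R) (b := R)) K) y =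
      ∫ y : ℝ, (Icc (-R) R).indicator (fun y =>
        Complex.exp (((-2 * Real.pi * inner ℝ y x : ℝ) : ℂ) * Complex.I) * G y) y := by
    refine integral_congr_ae ?_
    filter_upwards [hcoe] with y hy
    rw [hy]
    by_cases h : y ∈ Icc (-R) R <;> simp only [h, indicator_of_mem, indicator_of_notMem,
      not_false_eq_true, mul_zero]
  rw [h4, Complex.exp_neg]
  have he := Complex.exp_ne_zero (Real.pi * x)
  have hpi' : (Real.pi : ℂ) ≠ 0 := by exact_mod_cast hpi.ne'
  generalize ∫ y : ℝ, (Icc (-R) R).indicator (fun y =>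
    Complex.exp (((-2 * Real.pi * inner ℝ y x : ℝ) : ℂ) * Complex.I) * G y) y = J
  push_cast
  field_simp
  linear_combination (-J) * hsq

/-- `logPull` preserves the L² norm, so the limit can be taken in L²(ℝ), where the truncations are
Fourier transforms of cut-offs of K. -/
theorem tendsto_outerTrunc_iff {G : ℝ → ℂ} {K : L2Line} (hK : K =ᵐ[volume] G) (h : L2Pos) :
    Filter.Tendsto (fun R : ℝ => eLpNorm (fun t => outerTrunc G R t - h t) 2
      (volume.restrict (Ioi 0))) Filter.atTop (𝓝 0) ↔
      mellinQ h = (√(2 * Real.pi) : ℂ)⁻¹ • K := by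
  have hlim : Filter.Tendsto (fun R : ℝ => (√(2 * Real.pi) : ℂ)⁻¹ • Lp.fourierTransformₗᵢ ℝ ℂ
      (indicatorLp (measurableSet_Icc (a := -R) (b := R)) K)) Filter.atTop
      (𝓝 ((√(2 * Real.pi) : ℂ)⁻¹ • Lp.fourierTransformₗᵢ ℝ ℂ K)) := by
    refine (((Lp.fourierTransformₗᵢ ℝ ℂ).continuous.tendsto K).comp (tendsto_indicatorLp
      (s := fun R : ℝ => Icc (-R) R) (fun R => measurableSet_Icc) K ?_)).const_smul _
    refine Filter.Eventually.of_forall fun x => ?_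
    filter_upwards [Filter.eventually_ge_atTop |x|] with R hR
    exact abs_le.mp hR
  have hsub : ∀ R : ℝ, eLpNorm (fun t => outerTrunc G R t - h t) 2 (volume.restrict (Ioi 0)) =
      eLpNorm (fun x => logPull (outerTrunc G R) x - logPull h x) 2 volume := fun R => by
    rw [← eLpNorm_logPull]
    congr 1 with x
    simp only [logPull, mul_sub]
  have hcoe : (logPullEquiv h : ℝ → ℂ) =ᵐ[volume] logPull h :=
    MemLp.coeFn_toLp (logPull_memLp h)
  simp only [hsub]
  rw [tendsto_eLpNorm_sub_iff
    (Filter.Eventually.of_forall fun R => logPull_outerTrunc_ae_eq hK R) hcoe]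
  have hiff : mellinQ h = (√(2 * Real.pi) : ℂ)⁻¹ • K ↔
      logPullEquiv h = (√(2 * Real.pi) : ℂ)⁻¹ • Lp.fourierTransformₗᵢ ℝ ℂ K := by
    rw [mellinQ, LinearIsometryEquiv.trans_apply, LinearIsometryEquiv.symm_apply_eq, map_smul]
  rw [hiff]
  exact ⟨fun h => tendsto_nhds_unique h hlim, fun h => h ▸ hlim⟩

theorem mulOp_coeFn (g : Lp ℂ ∞ (volume : Measure ℝ)) (F : L2Line) :
    mulOp g F =ᵐ[volume] fun y => g y * F y :=
  (ContinuousLinearMap.mul ℂ ℂ).coeFn_holder g F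

theorem isMellinDoubleIntegral_iff (g : Lp ℂ ∞ (volume : Measure ℝ)) (f h : L2Pos) :
    IsMellinDoubleIntegral g f h ↔ h = mellinMultiplier g f := by
  have hmult : mellinMultiplier g f = mellinQ.symm (mulOp g (mellinQ f)) := rfl
  simp only [IsMellinDoubleIntegral, tendsto_innerTrunc_iff, exists_eq_left,
    tendsto_outerTrunc_iff (mulOp_coeFn g _)]
  rw [map_smul, inv_smul_smul₀ sqrt_two_pi_ne_zero, hmult, LinearIsometryEquiv.eq_symm_apply]

/-! ### Diagonalization of the Hardy operator -/

theorem restrict_Ioi_Ioc_ne_top (a : ℝ) : (volume.restrict (Ioi (0 : ℝ))) (Ioc 0 a) ≠ ∞ :=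
  ((Measure.restrict_apply_le _ _).trans_lt measure_Ioc_lt_top).ne

/-- The indicator function of `(0, a]` in `L²(0, ∞)`. -/
noncomputable def initialIndicator (a : ℝ) : L2Pos :=
  indicatorConstLp 2 (measurableSet_Ioc (a := (0 : ℝ)) (b := a)) (restrict_Ioi_Ioc_ne_top a) 1

theorem initialIndicator_coeFn (a : ℝ) :
    initialIndicator a =ᵐ[volume.restrict (Ioi 0)] (Ioc 0 a).indicator fun _ => (1 : ℂ) :=
  indicatorConstLp_coeFn

/-- By Lebesgue differentiation f is a.e. the derivative of its primitive, which vanishes on (0, ∞).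
-/
theorem L2Pos.eq_zero_of_forall_setIntegral_Ioc (f : L2Pos)
    (h : ∀ a : ℝ, 0 < a → ∫ t in Ioc 0 a, f t = 0) : f = 0 := by
  have hmem : MemLp ((Ioi 0).indicator f) 2 volume :=
    (memLp_indicator_iff_restrict measurableSet_Ioi).mpr (Lp.memLp f)
  have hd := LocallyIntegrable.ae_hasDerivAt_integral (hmem.locallyIntegrable (by norm_num))
  rw [Lp.eq_zero_iff_ae_eq_zero]
  filter_upwards [ae_restrict_of_ae hd, ae_restrict_mem measurableSet_Ioi] with x hx hx0
  have h0 : (fun z : ℝ => ∫ t in (0 : ℝ)..z, (Ioi 0).indicator f t) =ᶠ[𝓝 x] fun _ => 0 := by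
    filter_upwards [Ioi_mem_nhds hx0] with z hz
    rw [intervalIntegral.integral_of_le (le_of_lt hz), setIntegral_indicator measurableSet_Ioi,
      inter_eq_self_of_subset_left Ioc_subset_Ioi_self, h z hz]
  have h1 := (hx 0).unique ((hasDerivAt_const x (0 : ℂ)).congr_of_eventuallyEq h0)
  rwa [indicator_of_mem hx0] at h1

theorem dense_span_initialIndicator :
    Dense (Submodule.span ℂ (initialIndicator '' Ioi 0) : Set L2Pos) := by
  rw [Submodule.dense_iff_topologicalClosure_eq_top, Submodule.topologicalClosure_eq_top_iff,
    Submodule.eq_bot_iff]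
  intro f hf
  refine L2Pos.eq_zero_of_forall_setIntegral_Ioc f fun a ha => ?_
  have h1 := (Submodule.mem_orthogonal _ _).mp hf _ (Submodule.subset_span (mem_image_of_mem _ ha))
  rwa [initialIndicator, L2.inner_indicatorConstLp_one, Measure.restrict_restrict measurableSet_Ioc,
    inter_eq_self_of_subset_left Ioc_subset_Ioi_self] at h1

theorem hardyInfty_coeFn (f : L2Pos) : hardyInfty f =ᵐ[volume.restrict (Ioi 0)] hardyFun f :=
  MemLp.coeFn_toLp (hardyFun_memLp f)

/-- The average over (0, x] is min(x, a)/x. The tail a/x is written as a complex power so that it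
merges with the Mellin kernel. -/
theorem hardyInfty_initialIndicator_coeFn {a : ℝ} (ha : 0 < a) :
    hardyInfty (initialIndicator a) =ᵐ[volume.restrict (Ioi 0)]
      fun x => (Ioc 0 a).indicator (fun _ => (1 : ℂ)) x +
        (Ioi a).indicator (fun x : ℝ => (a : ℂ) * (x : ℂ) ^ (-1 : ℂ)) x := by
  filter_upwards [hardyInfty_coeFn (initialIndicator a), ae_restrict_mem measurableSet_Ioi]
    with x hx hx0
  have hx0' : (0 : ℝ) < x := hx0
  rw [hx, hardyFun, setIntegral_Ioc_congr (initialIndicator_coeFn a),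
    setIntegral_indicator measurableSet_Ioc, Ioc_inter_Ioc, max_self, setIntegral_const,
    Real.volume_real_Ioc_of_le (le_min hx0'.le ha.le)]
  simp only [Complex.cpow_neg_one]
  have hxc : (x : ℂ) ≠ 0 := by exact_mod_cast hx0'.ne'
  rcases le_or_gt x a with hxa | hxa
  · rw [indicator_of_mem (show x ∈ Ioc 0 a from ⟨hx0, hxa⟩),
      indicator_of_notMem (show x ∉ Ioi a from not_lt.mpr hxa), min_eq_left hxa]
    simp [hxc]
  · rw [indicator_of_notMem (show x ∉ Ioc 0 a from fun h => not_le.mpr hxa h.2),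
      indicator_of_mem (show x ∈ Ioi a from hxa), min_eq_right hxa.le]
    simp [mul_comm]

/-- The symbol `1 / (1/2 - iy)` of the Hardy operator. -/
noncomputable def hardySymbol (y : ℝ) : ℂ := (1 / 2 - Complex.I * (y : ℂ))⁻¹

theorem half_sub_ne_zero (y : ℝ) : (1 / 2 - Complex.I * (y : ℂ)) ≠ 0 := fun h => by
  simpa using congrArg Complex.re h

theorem half_add_ne_zero (y : ℝ) : (1 / 2 + Complex.I * (y : ℂ)) ≠ 0 := fun h => by
  simpa using congrArg Complex.re h

theorem setIntegral_Ioc_cpow {a : ℝ} (ha : 0 < a) (y : ℝ) :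
    ∫ t in Ioc 0 a, (t : ℂ) ^ (Complex.I * (y : ℂ) - 1 / 2) =
      (a : ℂ) ^ (Complex.I * (y : ℂ) + 1 / 2) / (1 / 2 + Complex.I * (y : ℂ)) := by
  have he : Complex.I * (y : ℂ) - 1 / 2 + 1 = 1 / 2 + Complex.I * (y : ℂ) := by ring
  rw [← intervalIntegral.integral_of_le ha.le, integral_cpow (Or.inl (by simp; norm_num)), he,
    Complex.ofReal_zero, Complex.zero_cpow (half_add_ne_zero y), sub_zero, add_comm (1 / 2 : ℂ)]

theorem setIntegral_Ioi_mul_cpow {a : ℝ} (ha : 0 < a) (y : ℝ) :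
    ∫ t in Ioi a, (a : ℂ) * (t : ℂ) ^ (-1 + (Complex.I * (y : ℂ) - 1 / 2)) =
      (a : ℂ) ^ (Complex.I * (y : ℂ) + 1 / 2) / (1 / 2 - Complex.I * (y : ℂ)) := by
  have hac : (a : ℂ) ≠ 0 := by exact_mod_cast ha.ne'
  rw [integral_const_mul, integral_Ioi_cpow_of_lt (by simp) ha,
    show Complex.I * (y : ℂ) + 1 / 2 = 1 + (-1 + (Complex.I * (y : ℂ) - 1 / 2) + 1) by ring,
    Complex.cpow_add 1 _ hac, Complex.cpow_one,
    show -1 + (Complex.I * (y : ℂ) - 1 / 2) + 1 = -(1 / 2 - Complex.I * (y : ℂ)) by ring,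
    neg_div_neg_eq, mul_div_assoc]

theorem integrableOn_Ioc_cpow {a : ℝ} (ha : 0 < a) (y : ℝ) :
    IntegrableOn (fun t : ℝ => (t : ℂ) ^ (Complex.I * (y : ℂ) - 1 / 2)) (Ioc 0 a) := by
  rw [← intervalIntegrable_iff_integrableOn_Ioc_of_le ha.le]
  exact intervalIntegral.intervalIntegrable_cpow' (by simp; norm_num)

theorem integrableOn_Ioi_mul_cpow {a : ℝ} (ha : 0 < a) (y : ℝ) :
    IntegrableOn (fun t : ℝ => (a : ℂ) * (t : ℂ) ^ (-1 + (Complex.I * (y : ℂ) - 1 / 2)))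
      (Ioi a) :=
  (integrableOn_Ioi_cpow_of_lt (by simp) ha).const_mul _

theorem mellinQ_initialIndicator_coeFn {a : ℝ} (ha : 0 < a) :
    mellinQ (initialIndicator a) =ᵐ[volume] fun y : ℝ => (1 / (√(2 * Real.pi) : ℂ)) *
      ((a : ℂ) ^ (Complex.I * (y : ℂ) + 1 / 2) / (1 / 2 + Complex.I * (y : ℂ))) := by
  have hae : ∀ s : ℂ, (fun t : ℝ => initialIndicator a t * (t : ℂ) ^ s)
      =ᵐ[volume.restrict (Ioi 0)] (Ioc 0 a).indicator fun t : ℝ => (t : ℂ) ^ s := fun s => by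
    filter_upwards [initialIndicator_coeFn a] with t ht
    rw [ht]
    by_cases h : t ∈ Ioc 0 a <;> simp only [h, indicator_of_mem, indicator_of_notMem,
      not_false_eq_true, zero_mul, one_mul]
  refine (mellinQ_ae_eq (initialIndicator a) ?_).trans (Filter.Eventually.of_forall fun y => ?_)
  · refine Integrable.congr ?_ (hae _).symm
    have := integrableOn_Ioc_cpow ha 0
    simp only [Complex.ofReal_zero, mul_zero, zero_sub] at this
    exact (this.integrable_indicator measurableSet_Ioc).restrict
  · simp only
    rw [integral_congr_ae (hae _), setIntegral_indicator measurableSet_Ioc,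
      inter_eq_self_of_subset_right Ioc_subset_Ioi_self, setIntegral_Ioc_cpow ha]

theorem mellinQ_hardyInfty_initialIndicator_coeFn {a : ℝ} (ha : 0 < a) :
    mellinQ (hardyInfty (initialIndicator a)) =ᵐ[volume] fun y : ℝ =>
      (1 / (√(2 * Real.pi) : ℂ)) *
        ((a : ℂ) ^ (Complex.I * (y : ℂ) + 1 / 2) / (1 / 2 + Complex.I * (y : ℂ)) +
          (a : ℂ) ^ (Complex.I * (y : ℂ) + 1 / 2) / (1 / 2 - Complex.I * (y : ℂ))) := by
  have hae : ∀ s : ℂ, (fun t : ℝ => hardyInfty (initialIndicator a) t * (t : ℂ) ^ s)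
      =ᵐ[volume.restrict (Ioi 0)] fun t => (Ioc 0 a).indicator (fun t : ℝ => (t : ℂ) ^ s) t +
        (Ioi a).indicator (fun t : ℝ => (a : ℂ) * (t : ℂ) ^ (-1 + s)) t := fun s => by
    filter_upwards [hardyInfty_initialIndicator_coeFn ha, ae_restrict_mem measurableSet_Ioi]
      with t ht ht0
    have htc : (t : ℂ) ≠ 0 := by exact_mod_cast (show (0 : ℝ) < t from ht0).ne'
    rw [ht, add_mul]
    congr 1
    · by_cases h : t ∈ Ioc 0 a <;> simp only [h, indicator_of_mem, indicator_of_notMem,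
        not_false_eq_true, zero_mul, one_mul]
    · by_cases h : t ∈ Ioi a <;> simp only [h, indicator_of_mem, indicator_of_notMem,
        not_false_eq_true, zero_mul, mul_assoc, Complex.cpow_add _ _ htc]
  have hint : ∀ y : ℝ, Integrable ((Ioc 0 a).indicator fun t : ℝ =>
      (t : ℂ) ^ (Complex.I * (y : ℂ) - 1 / 2)) (volume.restrict (Ioi 0)) := fun y =>
    ((integrableOn_Ioc_cpow ha y).integrable_indicator measurableSet_Ioc).restrict
  have hint' : ∀ y : ℝ, Integrable ((Ioi a).indicator fun t : ℝ =>
      (a : ℂ) * (t : ℂ) ^ (-1 + (Complex.I * (y : ℂ) - 1 / 2))) (volume.restrict (Ioi 0)) :=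
    fun y => ((integrableOn_Ioi_mul_cpow ha y).integrable_indicator measurableSet_Ioi).restrict
  refine (mellinQ_ae_eq (hardyInfty (initialIndicator a)) ?_).trans
    (Filter.Eventually.of_forall fun y => ?_)
  · refine Integrable.congr ?_ (hae _).symm
    have := (hint 0).add (hint' 0)
    simp only [Complex.ofReal_zero, mul_zero, zero_sub] at this
    exact this
  · simp only
    rw [integral_congr_ae (hae _), integral_add (hint y) (hint' y),
      setIntegral_indicator measurableSet_Ioc, setIntegral_indicator measurableSet_Ioi,
      inter_eq_self_of_subset_right Ioc_subset_Ioi_self,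
      inter_eq_self_of_subset_right (Ioi_subset_Ioi ha.le), setIntegral_Ioc_cpow ha,
      setIntegral_Ioi_mul_cpow ha]

theorem continuous_hardySymbol : Continuous hardySymbol := by
  unfold hardySymbol
  exact Continuous.inv₀ (by fun_prop) half_sub_ne_zero

theorem norm_hardySymbol_le (y : ℝ) : ‖hardySymbol y‖ ≤ 2 := by
  have h1 := Complex.abs_re_le_norm (1 / 2 - Complex.I * (y : ℂ))
  have h2 : |(1 / 2 - Complex.I * (y : ℂ)).re| = 1 / 2 := by simp
  rw [h2] at h1
  rw [hardySymbol, norm_inv]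
  exact (inv_anti₀ (by norm_num) h1).trans (by norm_num)

theorem memLp_hardySymbol : MemLp hardySymbol ∞ volume :=
  memLp_top_of_bound continuous_hardySymbol.aestronglyMeasurable 2
    (Filter.Eventually.of_forall norm_hardySymbol_le)

theorem mulOp_hardySymbol_coeFn (F : L2Line) :
    mulOp (memLp_hardySymbol.toLp _) F =ᵐ[volume] fun y => hardySymbol y * F y := by
  filter_upwards [mulOp_coeFn (memLp_hardySymbol.toLp _) F, memLp_hardySymbol.coeFn_toLp]
    with y h1 h2
  rw [h1, h2]

/-- The Mellin transform diagonalizes the Hardy operator. -/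
theorem mellinQ_hardyInfty (f : L2Pos) :
    mellinQ (hardyInfty f) = mulOp (memLp_hardySymbol.toLp _) (mellinQ f) := by
  have h : (mellinQ : L2Pos →L[ℂ] L2Line) ∘L hardyInfty =
      mulOp (memLp_hardySymbol.toLp _) ∘L (mellinQ : L2Pos →L[ℂ] L2Line) := by
    refine ContinuousLinearMap.ext_on dense_span_initialIndicator ?_
    rintro _ ⟨a, ha, rfl⟩
    refine Lp.ext ?_
    refine (mellinQ_hardyInfty_initialIndicator_coeFn ha).trans
      (Filter.EventuallyEq.symm ((mulOp_hardySymbol_coeFn _).trans ?_))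
    filter_upwards [mellinQ_initialIndicator_coeFn ha] with y hy
    refine (congrArg (hardySymbol y * ·) hy).trans ?_
    have h1 := half_sub_ne_zero y
    have h2 := half_add_ne_zero y
    have hs := sqrt_two_pi_ne_zero
    simp only [hardySymbol]
    generalize (a : ℂ) ^ (Complex.I * (y : ℂ) + 1 / 2) = c
    -- With p, q = 1/2 ± iy, the relation p + q = 1 gives 1/p + 1/q = (1/q)(1/p): adding the tail
    -- multiplies the transform of the indicator by the symbol 1/q.
    have hpq : (1 / 2 + Complex.I * (y : ℂ)) + (1 / 2 - Complex.I * (y : ℂ)) = 1 := by ring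
    generalize (1 / 2 + Complex.I * (y : ℂ)) = p at *
    generalize (1 / 2 - Complex.I * (y : ℂ)) = q at *
    field_simp
    linear_combination (-c) * hpq
  exact congrArg (fun T => T f) h

/-! ### The commutant of the Hardy operator -/

theorem mulOp_comm (g g' : Lp ℂ ∞ (volume : Measure ℝ)) (F : L2Line) :
    mulOp g (mulOp g' F) = mulOp g' (mulOp g F) := by
  refine Lp.ext ?_
  filter_upwards [mulOp_coeFn g (mulOp g' F), mulOp_coeFn g' F, mulOp_coeFn g' (mulOp g F),
    mulOp_coeFn g F] with y h1 h2 h3 h4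
  rw [h1, h2, h3, h4, mul_left_comm]

theorem mellinQ_mellinMultiplier (g : Lp ℂ ∞ (volume : Measure ℝ)) (f : L2Pos) :
    mellinQ (mellinMultiplier g f) = mulOp g (mellinQ f) :=
  mellinQ.apply_symm_apply _

theorem commute_mellinMultiplier_hardyInfty (g : Lp ℂ ∞ (volume : Measure ℝ)) :
    Commute (mellinMultiplier g) hardyInfty := by
  refine ContinuousLinearMap.ext fun f => mellinQ.injective ?_
  simp only [mul_apply_eq_comp]
  rw [mellinQ_mellinMultiplier, mellinQ_hardyInfty, mellinQ_hardyInfty, mellinQ_mellinMultiplier,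
    mulOp_comm]

/-- The operator `Q A Q⁻¹` on `L²(iℝ)`. -/
noncomputable def mellinConj (A : L2Pos →L[ℂ] L2Pos) : L2Line →L[ℂ] L2Line :=
  (mellinQ : L2Pos →L[ℂ] L2Line) ∘L A ∘L (mellinQ.symm : L2Line →L[ℂ] L2Pos)

theorem mellinConj_apply (A : L2Pos →L[ℂ] L2Pos) (F : L2Line) :
    mellinConj A F = mellinQ (A (mellinQ.symm F)) := rfl

theorem commutesWithMul_hardySymbol {A : L2Pos →L[ℂ] L2Pos} (hA : Commute A hardyInfty) :
    CommutesWithMul (mellinConj A) hardySymbol := by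
  intro f f' hf
  have h1 : f' = mellinQ (hardyInfty (mellinQ.symm f)) := by
    rw [mellinQ_hardyInfty, LinearIsometryEquiv.apply_symm_apply]
    exact Lp.ext (hf.trans (mulOp_hardySymbol_coeFn f).symm)
  have h2 : mellinConj A f' = mulOp (memLp_hardySymbol.toLp _) (mellinConj A f) := by
    rw [mellinConj_apply, mellinConj_apply, h1, LinearIsometryEquiv.symm_apply_apply,
      ← mellinQ_hardyInfty]
    have h3 : A (hardyInfty (mellinQ.symm f)) = hardyInfty (A (mellinQ.symm f)) :=
      DFunLike.congr_fun hA.eq (mellinQ.symm f)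
    rw [h3]
  rw [h2]
  exact mulOp_hardySymbol_coeFn _

/-- The symbol of `H_∞ - 1`. -/
noncomputable def cayleySymbol : ℝ →ᵇ ℂ :=
  ofNormedAddCommGroup hardySymbol continuous_hardySymbol 2 norm_hardySymbol_le +
    BoundedContinuousFunction.const ℝ (-1)

theorem cayleySymbol_apply (y : ℝ) : cayleySymbol y = hardySymbol y + -1 := rfl

/-- The symbol is conj z / z with z = 1/2 - iy. -/
theorem norm_cayleySymbol (y : ℝ) : ‖cayleySymbol y‖ = 1 := by
  have h : cayleySymbol y =
      conj (1 / 2 - Complex.I * (y : ℂ)) / (1 / 2 - Complex.I * (y : ℂ)) := by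
    rw [cayleySymbol_apply, hardySymbol, eq_div_iff (half_sub_ne_zero y), add_mul,
      inv_mul_cancel₀ (half_sub_ne_zero y)]
    simp only [map_sub, map_mul, map_div₀, map_one, map_ofNat, Complex.conj_I, Complex.conj_ofReal]
    ring
  rw [h, norm_div, Complex.norm_conj, div_self (norm_ne_zero_iff.mpr (half_sub_ne_zero y))]

theorem cayleySymbol_injective : Function.Injective cayleySymbol := by
  intro y z h
  rw [cayleySymbol_apply, cayleySymbol_apply, add_left_inj, hardySymbol, hardySymbol, inv_inj,
    sub_right_inj, mul_right_inj' Complex.I_ne_zero] at h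
  exact_mod_cast h

/-- Subtracting 1 from the Hardy symbol makes it unimodular, which supplies the commutation with the
conjugate that membership requires. -/
theorem cayleySymbol_mem_mulCommutant {A : L2Pos →L[ℂ] L2Pos} (hA : Commute A hardyInfty) :
    cayleySymbol ∈ mulCommutant (mellinConj A) := by
  have h : CommutesWithMul (mellinConj A) cayleySymbol :=
    CommutesWithMul.add (g := ofNormedAddCommGroup hardySymbol continuous_hardySymbol 2
      norm_hardySymbol_le) (commutesWithMul_hardySymbol hA) (CommutesWithMul.const _ (-1))
  exact ⟨h, h.conj_of_norm_eq_one norm_cayleySymbol⟩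

theorem exists_eq_mellinMultiplier {A : L2Pos →L[ℂ] L2Pos} (hA : Commute A hardyInfty) :
    ∃ g : Lp ℂ ∞ (volume : Measure ℝ), A = mellinMultiplier g := by
  have hS : ((mulCommutant (mellinConj A)).map (toContinuousMapStarₐ ℂ)).SeparatesPoints := by
    intro y z hyz
    -- One injective function separates all pairs of points.
    exact ⟨cayleySymbol, ⟨toContinuousMapStarₐ ℂ cayleySymbol,
      ⟨cayleySymbol, cayleySymbol_mem_mulCommutant hA, rfl⟩, rfl⟩,
      fun h => hyz (cayleySymbol_injective h)⟩
  obtain ⟨g, hg⟩ := exists_mul_of_commutesWithMul hS fun _ h => h.1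
  refine ⟨g, ContinuousLinearMap.ext fun f => mellinQ.injective ?_⟩
  rw [mellinQ_mellinMultiplier]
  refine Lp.ext (Filter.EventuallyEq.trans ?_ (mulOp_coeFn g (mellinQ f)).symm)
  have h := hg (mellinQ f)
  rwa [mellinConj_apply, LinearIsometryEquiv.symm_apply_apply] at h

end HardyMellin

open HardyMellin
theorem mainTheorem7 (A : L2Pos →L[ℂ] L2Pos) :
    (Commute A hardyInfty ↔
      ∃ g : Lp ℂ ∞ (volume : Measure ℝ), ∀ f : L2Pos, IsMellinDoubleIntegral g f (A f)) ∧
    (Commute A hardyInfty ↔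
      ∃ g : Lp ℂ ∞ (volume : Measure ℝ), A = mellinMultiplier g) ∧
    ∀ g : Lp ℂ ∞ (volume : Measure ℝ),
      (∀ f : L2Pos, IsMellinDoubleIntegral g f (A f)) ↔ A = mellinMultiplier g := by
  have h1 : ∀ g : Lp ℂ ∞ (volume : Measure ℝ),
      (∀ f : L2Pos, IsMellinDoubleIntegral g f (A f)) ↔ A = mellinMultiplier g := fun g => by
    simp only [isMellinDoubleIntegral_iff, ContinuousLinearMap.ext_iff]
  have h2 : Commute A hardyInfty ↔ ∃ g : Lp ℂ ∞ (volume : Measure ℝ), A = mellinMultiplier g :=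
    ⟨exists_eq_mellinMultiplier, fun ⟨g, hg⟩ => hg ▸ commute_mellinMultiplier_hardyInfty g⟩
  exact ⟨by simpa only [h1] using h2, h2, h1⟩
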